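/- Let $d\ge 0$ and let $\mathcal A$ be a finite non-empty alphabet. Let $\theta\colon\mathcal A\to\mathcal A^{\mathcal D}$ be a primitive digit substitution on $\mathbb Z^d$: $Q$ is an integer $d\times d$ matrix all of whose complex eigenvalues have modulus greater than $1$, and $\mathcal D\subset\mathbb Z^d$ is a complete set of representatives of $\mathbb Z^d/Q\mathbb Z^d$. Put $\theta^0(a)=a$ (at the origin), and let $\theta^{n}(a)$ be the union of the patterns $\theta(\theta^{n-1}(a)_{j})$ translated by $Qj$, over all $j$ in the support of $\theta^{n-1}(a)$; primitive means that for some $k$ every letter occurs in every $\theta^k(a)$. Let $\mathcal L_\theta$ be the set of finite patterns that occur, up to translation, in some $\theta^k(a)$, $a\in\mathcal A$, $k\ge1$. Assume that $\mathcal L_\theta$ is extensible (for finite $B\subseteq U\subset\mathbb Z^d$, each pattern of $\mathcal L_\theta$ with support $B$ extends to one with support $U$), and let $\mathbb X=\mathbb X_\theta\subseteq\mathcal A^{\mathbb Z^d}$ be the shift space of all configurations whose finite patterns all belong to $\mathcal L_\theta$, with the shifts $\sigma_n(x)_i=x_{i+n}$. A continuous map $f\colon\mathbb X\to\mathbb S^1$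 is an eigenfunction if $f\circ\sigma_n$ is a constant multiple of $f$ for every $n\in\mathbb Z^d$. Fix $x_0\in\mathbb X$ and let $\mathcal L$ be the subgroup of $\mathbb Z^d$ generated by all $j$ such that $(x_0)_{j+k}=(x_0)_k$ for some $k\in\mathbb Z^d$. The height lattice $\Gamma$ is the smallest subgroup of $\mathbb Z^d$ such that $\mathcal L\subseteq\Gamma$, $Q\Gamma\subseteq\Gamma$ and $\Gamma+Q\mathbb Z^d=\mathbb Z^d$. Then $\mathbb X$ is non-empty and, for every choice of $x_0$, the lattice $\Gamma$ exists; if there is also a smallest subgroup among all $\Lambda\supseteq\mathcal L$ with $\Lambda+Q\mathbb Z^d=\mathbb Z^d$, whether $Q$-invariant or not, then it equals $\Gamma$. Moreover, every continuous eigenfunction $f\colon\mathbb X\to\mathbb S^1$ is a product $f=f_{\mathrm{tile}}\cdot h$ of two continuous eigenfunctions $f_{\mathrm{tile}},h\colon\mathbb X\to\mathbb S^1$ such that, for some $k\ge 0$, $f_{\mathrm{tile}}\circ\sigma_n=f_{\mathrm{tile}}$ for all $n\in Q^k\mathbb Z^d$, and $h\circ\sigma_n=h$ for all $n\in\Gamma$.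 -/

import Mathlib

/-- A digit substitution on `ℤ^d` over the alphabet `A`: an expansive integer matrix `Q`
(all complex eigenvalues have modulus `> 1`), a complete set `digits` of representatives of the
cosets of `Q ℤ^d` in `ℤ^d`, and a rule `θ : A → A^digits`. -/
structure DigitSubstitution (d : ℕ) (A : Type*) where
  /-- the inflation matrix -/
  Q : Matrix (Fin d) (Fin d) ℤ
  expansive : ∀ z ∈ spectrum ℂ (Q.map (Int.cast : ℤ → ℂ)), 1 < ‖z‖
  /-- the digit set -/
  digits : Finset (Fin d → ℤ)
  complete : ∀ v : Fin d → ℤ, ∃! e, e ∈ digits ∧ ∃ m : Fin d → ℤ, v = Q.mulVec m + e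
  /-- the rule `θ`; `rule a e` is the symbol of `θ(a)` at the position `e` -/
  rule : A → digits → A

namespace DigitSubstitution

variable {d : ℕ} {A : Type*}

/-- `θ.Supertile n a v b` says that the position `v` lies in the support of the `n`-supertile
`θ^n(a)` and that the symbol there is `b`. In other words, this is the graph of `θ^n(a)`, where
`θ^0(a)` is the symbol `a` at the origin and `θ^(n+1)(a)` is the union over the positions `j` of
`θ^n(a)` of the patterns `θ(θ^n(a)_j)` translated by `Q j`. -/
def Supertile (θ : DigitSubstitution d A) : ℕ → A → (Fin d → ℤ) → A → Prop
  | 0, a, v, b => v = 0 ∧ b = a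
  | n + 1, a, v, b => ∃ (j : Fin d → ℤ) (c : A) (e : θ.digits),
      θ.Supertile n a j c ∧ v = θ.Q.mulVec j + e ∧ b = θ.rule c e

/-- The patterns with finite support `B` in the language of `θ`: those that occur, up to
translation, in some supertile `θ^k(a)` with `k ≥ 1`. -/
def language (θ : DigitSubstitution d A) (B : Finset (Fin d → ℤ)) : Set (B → A) :=
  {P | ∃ (a : A) (k : ℕ) (t : Fin d → ℤ), 1 ≤ k ∧ ∀ b : B, θ.Supertile k a (b + t) (P b)}

/-- The language is extensible: every legal pattern extends to a legal pattern on every larger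
finite support. -/
def Extensible (θ : DigitSubstitution d A) : Prop :=
  ∀ (B : Finset (Fin d → ℤ)) (P : B → A), P ∈ θ.language B →
    ∀ (U : Finset (Fin d → ℤ)) (hU : B ⊆ U),
      ∃ R ∈ θ.language U, ∀ b : B, R ⟨b, hU b.2⟩ = P b

/-- For some `k`, every letter occurs in every supertile `θ^k(a)`. -/
def Primitive (θ : DigitSubstitution d A) : Prop :=
  ∃ k : ℕ, ∀ a b : A, ∃ v : Fin d → ℤ, θ.Supertile k a v b

/-- The shift space `𝕏_θ`: all configurations all of whose finite patterns are legal. -/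
def shiftSpace (θ : DigitSubstitution d A) : Set ((Fin d → ℤ) → A) :=
  {x | ∀ B : Finset (Fin d → ℤ), (fun b : B => x b) ∈ θ.language B}

/-- The shift `σ_n` on `𝕏_θ`, given by `(σ_n x)_i = x_{i+n}`. -/
def shift (θ : DigitSubstitution d A) (n : Fin d → ℤ) (x : θ.shiftSpace) : θ.shiftSpace :=
  ⟨fun i => x.1 (i + n), by
    classical
    intro B
    obtain ⟨a, k, t, hk, h⟩ := x.2 (B.image (fun b => b + n))
    refine ⟨a, k, n + t, hk, fun b => ?_⟩
    have h' := h ⟨b + n, Finset.mem_image_of_mem _ b.2⟩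
    simpa [add_assoc] using h'⟩

/-- Continuous eigenfunctions `f : 𝕏_θ → 𝕊¹`: for every `n`, the function `f ∘ σ_n` is a constant
multiple of `f`. -/
def IsEigenfunction [TopologicalSpace A] (θ : DigitSubstitution d A)
    (f : θ.shiftSpace → Circle) : Prop :=
  Continuous f ∧ ∀ n : Fin d → ℤ, ∃ c : Circle, ∀ x : θ.shiftSpace, f (θ.shift n x) = c * f x

/-- The set `Ξ` of return times, read off from the reference point `x`. -/
def returnTimes (x : (Fin d → ℤ) → A) : Set (Fin d → ℤ) :=
  {j | ∃ k : Fin d → ℤ, x (j + k) = x k}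

/-- The return module, generated by the return times. -/
def returnModule (x : (Fin d → ℤ) → A) : AddSubgroup (Fin d → ℤ) :=
  AddSubgroup.closure (returnTimes x)

/-- `Λ` is coprime with the supertile lattice: `Λ + Q ℤ^d = ℤ^d`. -/
def CoprimeToSupertiles (θ : DigitSubstitution d A) (Λ : AddSubgroup (Fin d → ℤ)) : Prop :=
  ∀ w : Fin d → ℤ, ∃ u ∈ Λ, ∃ m : Fin d → ℤ, w = u + θ.Q.mulVec m

/-- `Γ` is the height lattice: the smallest `Q`-invariant lattice that contains the return module
and is coprime with `Q ℤ^d`. Without `Q`-invariance a smallest lattice need not exist: for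
`Q = diag(3, 2)` and return module `2ℤ × 2ℤ`, both `2ℤ × ℤ` and `{(a, b) | a + b even}` are minimal
among the lattices that contain the return module and are coprime with `Q ℤ²`. -/
def IsHeightLattice (θ : DigitSubstitution d A) (x : θ.shiftSpace)
    (Γ : AddSubgroup (Fin d → ℤ)) : Prop :=
  IsLeast {Λ : AddSubgroup (Fin d → ℤ) |
    returnModule x.1 ≤ Λ ∧ θ.CoprimeToSupertiles Λ ∧ ∀ v ∈ Λ, θ.Q.mulVec v ∈ Λ} Γ

end DigitSubstitution

/-! The return module `L` is `Q`-invariant, because legal patterns recur in `x₀`, and has finite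
index, by pigeonhole. So `Q` acts on the finite group `ℤ^d / L`. The eventual kernel of this action,
lifted to `ℤ^d`, is `Γ` (`AddSubgroup.eventualComap`). For an invariant `Λ ⊇ L`, coprimality means
that `Q` acts surjectively, hence injectively, on `ℤ^d / Λ`, which forces `Γ ≤ Λ`.

Let `f ∘ σ_n = χ(n) f`. If `j` is a return time, `Q^n j` joins two equal `n`-supertiles in a point
of the shift space, so `χ(Q^n j) → 1` uniformly in `j`. As `N ℤ^d ⊆ L` for some `N`, `χ^N (Q^n v) →
1` for all `v`, and expansiveness turns this into `χ^N = 1` on some `Q^n ℤ^d`. Then the values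
`χ(Q^n j)` are `N`-th roots of unity close to `1`, so they equal `1`. Hence `χ` is trivial on `Q^n
L`, and on `Q^k Γ` for a larger `k`.

Since `Γ + Q^k ℤ^d = ℤ^d`, some character `η` is trivial on `Γ` and equals `χ` on `Q^k ℤ^d`. Being
trivial on `L`, it has an eigenfunction `h`, and `f / h` is invariant under `Q^k ℤ^d`. -/

open Filter Topology

/-! ### Endomorphisms of an abelian group modulo an invariant subgroup -/

section EndomorphismsModuloSubgroup

variable {V : Type*} [AddCommGroup V]

/-- The elements that some iterate of `q` maps into `L`. -/
def AddSubgroup.eventualComap (q : V →+ V) (L : AddSubgroup V) (hL : ∀ v ∈ L, q v ∈ L) :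
    AddSubgroup V where
  carrier := {v | ∃ i : ℕ, q^[i] v ∈ L}
  zero_mem' := ⟨0, L.zero_mem⟩
  add_mem' := by
    have key : ∀ (i j : ℕ) (v : V), q^[i] v ∈ L → q^[j + i] v ∈ L := by
      intro i j v h
      induction j with
      | zero => simpa using h
      | succ j ih => rw [Nat.succ_add, Function.iterate_succ_apply']; exact hL _ ih
    rintro a b ⟨i, hi⟩ ⟨j, hj⟩
    refine ⟨i + j, ?_⟩
    rw [iterate_map_add]
    exact L.add_mem (by rw [add_comm]; exact key _ _ _ hi) (key _ _ _ hj)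
  neg_mem' := by
    rintro a ⟨i, hi⟩
    exact ⟨i, by rw [iterate_map_neg]; exact L.neg_mem hi⟩

/-- Coprimality makes the induced map on the finite group `V ⧸ Λ` surjective, hence injective. -/
theorem AddSubgroup.mem_of_map_mem {q : V →+ V} {Λ : AddSubgroup V} [Finite (V ⧸ Λ)]
    (hinv : ∀ v ∈ Λ, q v ∈ Λ) (hcop : ∀ w, ∃ u ∈ Λ, ∃ m, w = u + q m) {v : V} (h : q v ∈ Λ) :
    v ∈ Λ := by
  let qb : V ⧸ Λ →+ V ⧸ Λ := QuotientAddGroup.map Λ Λ q hinv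
  have hs : Function.Surjective qb := by
    intro g
    obtain ⟨w, rfl⟩ := QuotientAddGroup.mk_surjective g
    obtain ⟨u, hu, m, rfl⟩ := hcop w
    refine ⟨(m : V ⧸ Λ), ?_⟩
    change ((q m : V) : V ⧸ Λ) = _
    rw [QuotientAddGroup.eq]
    simpa using hu
  have hi := Finite.injective_iff_surjective.mpr hs
  have h0 : qb (v : V ⧸ Λ) = qb 0 := by
    rw [map_zero]
    exact (QuotientAddGroup.eq_zero_iff _).mpr h
  exact (QuotientAddGroup.eq_zero_iff _).mp (hi h0)

theorem AddSubgroup.mem_of_iterate_mem {q : V →+ V} {Λ : AddSubgroup V} [Finite (V ⧸ Λ)]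
    (hinv : ∀ v ∈ Λ, q v ∈ Λ) (hcop : ∀ w, ∃ u ∈ Λ, ∃ m, w = u + q m) :
    ∀ (i : ℕ) {v : V}, q^[i] v ∈ Λ → v ∈ Λ
  | 0, _, h => h
  | i + 1, _, h => by
    rw [Function.iterate_succ_apply'] at h
    exact mem_of_iterate_mem hinv hcop i (mem_of_map_mem hinv hcop h)

theorem AddSubgroup.exists_eq_add_iterate {q : V →+ V} {Λ : AddSubgroup V}
    (hinv : ∀ v ∈ Λ, q v ∈ Λ) (hcop : ∀ w, ∃ u ∈ Λ, ∃ m, w = u + q m) (i : ℕ) (w : V) :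
    ∃ u ∈ Λ, ∃ m, w = u + q^[i] m := by
  induction i generalizing w with
  | zero => exact ⟨0, Λ.zero_mem, w, by simp⟩
  | succ i ih =>
    obtain ⟨u, hu, m, rfl⟩ := hcop w
    obtain ⟨u', hu', m', rfl⟩ := ih m
    exact ⟨u + q u', Λ.add_mem hu (hinv _ hu'), m', by
      rw [Function.iterate_succ_apply', map_add, add_assoc]⟩

variable {q : V →+ V} {L : AddSubgroup V} (hL : ∀ v ∈ L, q v ∈ L)

theorem AddSubgroup.le_eventualComap : L ≤ L.eventualComap q hL := fun _ hv => ⟨0, hv⟩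

theorem AddSubgroup.map_mem_eventualComap {v : V} (hv : v ∈ L.eventualComap q hL) :
    q v ∈ L.eventualComap q hL := by
  obtain ⟨i, hi⟩ := hv
  refine ⟨i, ?_⟩
  rw [← Function.iterate_succ_apply, Function.iterate_succ_apply']
  exact hL _ hi

/-- The orbit of `w` in the finite group `V ⧸ L` repeats: `q^i w ≡ q^j w` with `i < j`. So `q^i`
maps `w - q^(j-i) w` into `L`. -/
theorem AddSubgroup.eventualComap_coprime [Finite (V ⧸ L)] (w : V) :
    ∃ u ∈ L.eventualComap q hL, ∃ m, w = u + q m := by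
  have key : ∀ i j : ℕ, i < j → ((q^[i] w : V) : V ⧸ L) = (q^[j] w : V) →
      ∃ u ∈ L.eventualComap q hL, ∃ m, w = u + q m := by
    intro i j hij h
    obtain ⟨k, rfl⟩ := Nat.exists_eq_add_of_lt hij
    refine ⟨w - q (q^[k] w), ⟨i, ?_⟩, q^[k] w, by simp⟩
    rw [iterate_map_sub, ← Function.iterate_succ_apply' q, ← Function.iterate_add_apply,
      sub_eq_add_neg, add_comm]
    rw [eq_comm, QuotientAddGroup.eq] at h
    simpa [add_assoc] using h
  obtain ⟨i, j, hne, h⟩ :=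
    Finite.exists_ne_map_eq_of_infinite (fun i : ℕ => ((q^[i] w : V) : V ⧸ L))
  rcases lt_or_gt_of_ne hne with hlt | hlt
  · exact key i j hlt h
  · exact key j i hlt h.symm

/-- The exponent can be chosen to depend only on the class modulo `L`, and there are finitely many
classes. -/
theorem AddSubgroup.exists_uniform_eventualComap [Finite (V ⧸ L)] :
    ∃ K : ℕ, ∀ v ∈ L.eventualComap q hL, q^[K] v ∈ L := by
  have mono : ∀ (i j : ℕ) (v : V), i ≤ j → q^[i] v ∈ L → q^[j] v ∈ L := by
    intro i j v hij h
    induction j, hij using Nat.le_induction with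
    | base => exact h
    | succ j _ ih => rw [Function.iterate_succ_apply']; exact hL _ ih
  have hcls : ∀ g : V ⧸ L, ∃ i : ℕ, ∀ v : V, (v : V ⧸ L) = g →
      v ∈ L.eventualComap q hL → q^[i] v ∈ L := by
    intro g
    by_cases hg : ∃ v : V, (v : V ⧸ L) = g ∧ v ∈ L.eventualComap q hL
    · obtain ⟨v, rfl, i, hi⟩ := hg
      refine ⟨i, fun v' hv' _ => ?_⟩
      have h0 : -v + v' ∈ L := QuotientAddGroup.eq.mp hv'.symm
      have h1 : q^[i] (-v + v') ∈ L := mono 0 i _ (Nat.zero_le _) h0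
      have h2 : v' = v + (-v + v') := by abel
      rw [h2, iterate_map_add]
      exact L.add_mem hi h1
    · push Not at hg
      exact ⟨0, fun v hv h => absurd h (hg v hv)⟩
  choose i hi using hcls
  obtain ⟨K, hK⟩ := (Set.finite_range i).bddAbove
  exact ⟨K, fun v hv => mono _ _ _ (hK ⟨(v : V ⧸ L), rfl⟩) (hi _ v rfl hv)⟩

theorem AddSubgroup.eventualComap_le [Finite (V ⧸ L)] {Λ : AddSubgroup V} (hLΛ : L ≤ Λ)
    (hinv : ∀ v ∈ Λ, q v ∈ Λ) (hcop : ∀ w, ∃ u ∈ Λ, ∃ m, w = u + q m) :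
    L.eventualComap q hL ≤ Λ := by
  have : Finite (V ⧸ Λ) :=
    Finite.of_surjective (QuotientAddGroup.map L Λ (AddMonoidHom.id V) hLΛ) (by
      intro g
      obtain ⟨w, rfl⟩ := QuotientAddGroup.mk_surjective g
      exact ⟨(w : V ⧸ L), rfl⟩)
  rintro v ⟨i, hi⟩
  exact mem_of_iterate_mem hinv hcop i (hLΛ hi)

/-- A smallest subgroup `Λ ⊇ L` with `Λ + q V = V` is invariant under `q`: the subgroup
`(1 + q) Λ + L` has the same property. -/
theorem AddSubgroup.map_mem_of_isLeast_coprime (hqL : ∀ v ∈ L, q v ∈ L) [Finite (V ⧸ L)]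
    {Λ : AddSubgroup V}
    (hΛ : IsLeast {Λ' : AddSubgroup V | L ≤ Λ' ∧ ∀ w, ∃ u ∈ Λ', ∃ m, w = u + q m} Λ)
    {v : V} (hv : v ∈ Λ) : q v ∈ Λ := by
  obtain ⟨⟨hLΛ, hcop⟩, hmin⟩ := hΛ
  let T : V →+ V := AddMonoidHom.id V + q
  have hTL : ∀ v ∈ L, T v ∈ L := fun v hv => L.add_mem hv (hqL v hv)
  let Tb : V ⧸ L →+ V ⧸ L := QuotientAddGroup.map L L T hTL
  -- Coprimality passes to `T Λ + L` because `u + q m = T u + q (m - u)`.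
  have hle : Λ ≤ Λ.map T ⊔ L := by
    refine hmin ⟨le_sup_right, fun w => ?_⟩
    obtain ⟨u, hu, m, rfl⟩ := hcop w
    refine ⟨T u, AddSubgroup.mem_sup_left ⟨u, hu, rfl⟩, m - u, ?_⟩
    change _ = (u + q u) + _
    rw [map_sub]; abel
  let S : Set (V ⧸ L) := (fun v : V => (v : V ⧸ L)) '' (Λ : Set V)
  have hS : S ⊆ Tb '' S := by
    rintro _ ⟨w, hw, rfl⟩
    obtain ⟨_, ⟨u, hu, rfl⟩, l, hl, rfl⟩ := AddSubgroup.mem_sup.mp (hle hw)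
    refine ⟨_, ⟨u, hu, rfl⟩, ?_⟩
    change ((T u : V) : V ⧸ L) = _
    rw [QuotientAddGroup.eq]
    simpa using hl
  -- An image of the finite set `S` has at most as many elements as `S`, so the inclusion is an
  -- equality and `T` preserves `Λ`.
  have hEq : S = Tb '' S :=
    Set.eq_of_subset_of_ncard_le hS (Set.ncard_image_le S.toFinite) (Set.toFinite _)
  have hTv : Tb (v : V ⧸ L) ∈ S := by rw [hEq]; exact ⟨_, ⟨v, hv, rfl⟩, rfl⟩
  obtain ⟨u, hu, huv⟩ := hTv
  have h1 : -u + T v ∈ L := QuotientAddGroup.eq.mp huv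
  have h2 : q v = u + (-u + T v) - v := by
    change _ = u + (-u + (v + q v)) - v
    abel
  rw [h2]
  exact Λ.sub_mem (Λ.add_mem hu (hLΛ h1)) hv

/-- A character that is trivial on `q^K Γ` splits as a character trivial on `q^K V` times a
character trivial on `Γ`. -/
theorem AddChar.exists_trivial_on_of_coprime {G : Type*} [CommGroup G] (χ : AddChar V G)
    {Γ : AddSubgroup V} (hinv : ∀ v ∈ Γ, q v ∈ Γ) (hcop : ∀ w, ∃ u ∈ Γ, ∃ m, w = u + q m)
    (hinj : ∀ (i : ℕ) (v : V), q^[i] v ∈ Γ → v ∈ Γ) {K : ℕ} (hχ : ∀ v ∈ Γ, χ (q^[K] v) = 1) :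
    ∃ η : AddChar V G, (∀ v ∈ Γ, η v = 1) ∧ ∀ m, η (q^[K] m) = χ (q^[K] m) := by
  choose u hu m hm using AddSubgroup.exists_eq_add_iterate hinv hcop K
  -- The value `η w = χ (q^K m)` does not depend on the decomposition `w = γ + q^K m`: two choices
  -- of `m` differ by an element of `Γ`, by `hinj`, and `χ ∘ q^K` is trivial there.
  have key : ∀ w γ m', γ ∈ Γ → w = γ + q^[K] m' → χ (q^[K] (m w)) = χ (q^[K] m') := by
    intro w γ m' hγ h
    have h1 : q^[K] (m w - m') ∈ Γ := by
      have h2 : q^[K] (m w - m') = γ - u w := by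
        rw [iterate_map_sub, sub_eq_sub_iff_add_eq_add, add_comm, ← hm w, h]
      rw [h2]
      exact Γ.sub_mem hγ (hu w)
    have h3 : q^[K] (m w) = q^[K] (m w - m') + q^[K] m' := by
      rw [← iterate_map_add, sub_add_cancel]
    rw [h3, AddChar.map_add_eq_mul, hχ _ (hinj _ _ h1), one_mul]
  refine ⟨⟨fun w => χ (q^[K] (m w)), ?_, fun a b => ?_⟩, fun v hv => ?_, fun v => ?_⟩
  · rw [key 0 0 0 Γ.zero_mem (by rw [iterate_map_zero, add_zero]), iterate_map_zero,
      AddChar.map_zero_eq_one]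
  · rw [key (a + b) (u a + u b) (m a + m b) (Γ.add_mem (hu a) (hu b)), iterate_map_add,
      AddChar.map_add_eq_mul]
    rw [iterate_map_add]
    conv_lhs => rw [hm a, hm b]
    abel
  · change χ (q^[K] (m v)) = 1
    rw [key v v 0 hv (by rw [iterate_map_zero, add_zero]), iterate_map_zero,
      AddChar.map_zero_eq_one]
  · exact key _ 0 v Γ.zero_mem (by rw [zero_add])

end EndomorphismsModuloSubgroup

/-! ### Expansive matrices and characters of `ℤ^d` -/

/-- The vectors with orbit tending to `0` form an invariant subspace. If it were nonzero it would
contain an eigenvector, whose orbit does not shrink. -/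
theorem Module.End.eq_zero_of_tendsto_pow_apply_zero {E : Type*} [NormedAddCommGroup E]
    [NormedSpace ℂ E] [FiniteDimensional ℂ E] (T : Module.End ℂ E)
    (hT : ∀ z, T.HasEigenvalue z → 1 < ‖z‖) {b : E}
    (hb : Tendsto (fun n : ℕ => (T ^ n) b) atTop (𝓝 0)) : b = 0 := by
  let W : Submodule ℂ E :=
    { carrier := {b | Tendsto (fun n : ℕ => (T ^ n) b) atTop (𝓝 0)}
      zero_mem' := by simp
      add_mem' := fun {x y} hx hy => by
        simpa using Tendsto.add (show Tendsto _ _ _ from hx) (show Tendsto _ _ _ from hy)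
      smul_mem' := fun c x hx => by
        simpa using Tendsto.const_smul (show Tendsto _ _ _ from hx) c }
  have hW : ∀ x ∈ W, T x ∈ W := by
    intro x hx
    have h := (tendsto_add_atTop_iff_nat 1).mpr (show Tendsto _ _ _ from hx)
    change Tendsto (fun n : ℕ => (T ^ n) (T x)) atTop (𝓝 0)
    simpa [pow_succ] using h
  by_contra hne
  have : Nontrivial W := ⟨⟨⟨b, hb⟩, 0, fun h => hne (congrArg Subtype.val h)⟩⟩
  obtain ⟨z, hz⟩ := Module.End.exists_eigenvalue (T.restrict hW)
  obtain ⟨w, hw⟩ := hz.exists_hasEigenvector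
  have hw0 : (w : E) ≠ 0 := fun h => hw.2 (Subtype.ext h)
  have hTw : T.HasEigenvector z (w : E) :=
    ⟨Module.End.mem_eigenspace_iff.mpr (congrArg Subtype.val hw.apply_eq_smul), hw0⟩
  have hz1 := hT z (Module.End.hasEigenvalue_of_hasEigenvector hTw)
  have hlim : Tendsto (fun n : ℕ => ‖(T ^ n) (w : E)‖) atTop (𝓝 0) := by
    have h : Tendsto (fun n : ℕ => (T ^ n) (w : E)) atTop (𝓝 0) := w.2
    simpa using h.norm
  have hge : ∀ n : ℕ, ‖(w : E)‖ ≤ ‖(T ^ n) (w : E)‖ := by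
    intro n
    rw [hTw.pow_apply, norm_smul, norm_pow]
    exact le_mul_of_one_le_left (norm_nonneg _) (one_le_pow₀ hz1.le)
  exact hw0 (norm_le_zero_iff.mp (ge_of_tendsto' hlim hge))

theorem Matrix.eq_zero_of_tendsto_pow_transpose_mulVec {d : ℕ} (M : Matrix (Fin d) (Fin d) ℂ)
    (hM : ∀ z ∈ spectrum ℂ M, 1 < ‖z‖) {b : Fin d → ℂ}
    (hb : Tendsto (fun n : ℕ => (M.transpose ^ n).mulVec b) atTop (𝓝 0)) : b = 0 := by
  refine Module.End.eq_zero_of_tendsto_pow_apply_zero (Matrix.toLin' M.transpose) (fun z hz => ?_)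
    (b := b) ?_
  · apply hM
    have h := hz.mem_spectrum
    rw [Matrix.spectrum_toLin', spectrum.mem_iff] at h
    rw [spectrum.mem_iff]
    contrapose! h
    have h' := Matrix.isUnit_transpose (algebraMap ℂ (Matrix (Fin d) (Fin d) ℂ) z - M) |>.mpr h
    rw [Matrix.transpose_sub] at h'
    simpa [Matrix.algebraMap_eq_diagonal] using h'
  · refine hb.congr fun n => ?_
    rw [← Matrix.toLin'_pow, Matrix.toLin'_apply]

/-- A character of `ℤ^d` whose compositions with the powers of an expansive matrix tend to `1`
pointwise is trivial on the range of some power. -/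
theorem AddChar.exists_forall_pow_mulVec_eq_one {d : ℕ} (Q : Matrix (Fin d) (Fin d) ℤ)
    (hQ : ∀ z ∈ spectrum ℂ (Q.map (Int.cast : ℤ → ℂ)), 1 < ‖z‖)
    (ψ : AddChar (Fin d → ℤ) Circle)
    (h : ∀ v, Tendsto (fun n : ℕ => ψ ((Q ^ n).mulVec v)) atTop (𝓝 1)) :
    ∃ n : ℕ, ∀ v, ψ ((Q ^ n).mulVec v) = 1 := by
  -- The principal angles of `ψ ∘ Q^n` on the standard basis; composition with `Q` acts on them by
  -- the transpose, modulo `2π`.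
  let c : ℕ → Fin d → ℝ := fun n i => Complex.arg (ψ ((Q ^ n).mulVec (Pi.single i 1)))
  have hexp : ∀ n i, Circle.exp (c n i) = ψ ((Q ^ n).mulVec (Pi.single i 1)) := fun n i =>
    Circle.exp_arg _
  have hc : ∀ i, Tendsto (fun n => c n i) atTop (𝓝 0) := by
    intro i
    have h1 : ContinuousAt Complex.arg ((1 : Circle) : ℂ) :=
      Complex.continuousAt_arg (by simp)
    have h2 : Tendsto (fun n : ℕ => ((ψ ((Q ^ n).mulVec (Pi.single i 1)) : Circle) : ℂ)) atTop
        (𝓝 ((1 : Circle) : ℂ)) :=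
      (continuous_subtype_val.tendsto (1 : Circle)).comp (h (Pi.single i 1))
    have h3 := h1.tendsto.comp h2
    rwa [Circle.coe_one, Complex.arg_one] at h3
  have hdec : ∀ v : Fin d → ℤ, v = ∑ j, v j • (Pi.single j (1 : ℤ) : Fin d → ℤ) := by
    intro v
    ext i
    simp [Finset.sum_apply, Pi.single_apply]
  have map_sum_prod : ∀ g : Fin d → Fin d → ℤ, ψ (∑ j, g j) = ∏ j, ψ (g j) := fun g =>
    map_sum ψ.toAddMonoidHom g Finset.univ
  have exp_sum : ∀ g : Fin d → ℝ, Circle.exp (∑ j, g j) = ∏ j, Circle.exp (g j) := fun g =>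
    map_sum Circle.expHom g Finset.univ
  have hψ : ∀ (n : ℕ) (v : Fin d → ℤ),
      ψ ((Q ^ n).mulVec v) = Circle.exp (∑ j, (v j : ℝ) * c n j) := by
    intro n v
    conv_lhs => rw [hdec v]
    rw [Matrix.mulVec_sum, map_sum_prod, exp_sum]
    refine Finset.prod_congr rfl fun j _ => ?_
    rw [Matrix.mulVec_smul, AddChar.map_zsmul_eq_zpow, ← hexp, ← Circle.exp_zsmul, zsmul_eq_mul]
  -- The two sides differ by a multiple of `2π` that tends to `0`, so they are eventually equal.
  have hrec : ∀ i, ∀ᶠ n in atTop, c (n + 1) i = ∑ j, (Q j i : ℝ) * c n j := by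
    intro i
    have hlim : Tendsto (fun n => c (n + 1) i - ∑ j, (Q j i : ℝ) * c n j) atTop (𝓝 0) := by
      have h1 := (tendsto_add_atTop_iff_nat 1).mpr (hc i)
      have h2 : Tendsto (fun n => ∑ j, (Q j i : ℝ) * c n j) atTop (𝓝 (∑ j, (Q j i : ℝ) * 0)) :=
        tendsto_finsetSum _ fun j _ => (hc j).const_mul _
      simpa using h1.sub h2
    have hev := hlim.eventually (Ioo_mem_nhds (neg_lt_zero.mpr Real.pi_pos) Real.pi_pos)
    filter_upwards [hev] with n hn
    have h1 : Circle.exp (c (n + 1) i - ∑ j, (Q j i : ℝ) * c n j) = 1 := by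
      rw [Circle.exp_sub, hexp, div_eq_one, pow_succ, ← Matrix.mulVec_mulVec, hψ]
      simp [Matrix.mulVec_single]
    have h2 := Circle.arg_exp hn.1 hn.2.le
    rw [h1] at h2
    simp only [Circle.coe_one, Complex.arg_one] at h2
    linarith
  obtain ⟨n₀, hn₀⟩ := eventually_atTop.mp (eventually_all.mpr hrec)
  let b : ℕ → Fin d → ℂ := fun n i => (c n i : ℂ)
  have hb : ∀ n, ((Q.map (Int.cast : ℤ → ℂ)).transpose ^ n).mulVec (b n₀) = b (n + n₀) := by
    intro n
    induction n with
    | zero => simp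
    | succ n ih =>
      rw [pow_succ', ← Matrix.mulVec_mulVec, ih]
      ext i
      have := hn₀ (n + n₀) (by omega) i
      simp only [b, Matrix.mulVec, dotProduct, Matrix.transpose_apply, Matrix.map_apply]
      rw [show n + 1 + n₀ = n + n₀ + 1 by omega, this]
      push_cast
      rfl
  have hb0 : b n₀ = 0 := by
    refine Matrix.eq_zero_of_tendsto_pow_transpose_mulVec _ hQ ?_
    simp only [hb]
    refine tendsto_pi_nhds.mpr fun i => ?_
    have h1 := (tendsto_add_atTop_iff_nat n₀).mpr (hc i)
    exact (Complex.continuous_ofReal.tendsto 0).comp h1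
  refine ⟨n₀, fun v => ?_⟩
  rw [hψ]
  have : ∀ j, c n₀ j = 0 := fun j => by
    have := congrFun hb0 j
    simpa [b] using this
  simp [this]

/-! ### Supertiles and recurrence of legal patterns -/

namespace DigitSubstitution

variable {d : ℕ} {A : Type*} (θ : DigitSubstitution d A)

theorem mulVec_injective : Function.Injective θ.Q.mulVec := by
  have h0 : IsUnit (θ.Q.map (Int.cast : ℤ → ℂ)) := by
    have h : (0 : ℂ) ∉ spectrum ℂ (θ.Q.map (Int.cast : ℤ → ℂ)) := fun h => by
      have := θ.expansive 0 h
      norm_num at this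
    rwa [spectrum.zero_notMem_iff] at h
  have hinj := Matrix.mulVec_injective_iff_isUnit.mpr h0
  have hcast : ∀ m : Fin d → ℤ, (fun i => ((θ.Q.mulVec m i : ℤ) : ℂ)) =
      (θ.Q.map (Int.cast : ℤ → ℂ)).mulVec (fun i => (m i : ℂ)) := by
    intro m
    ext i
    simp [Matrix.mulVec, dotProduct]
  intro m m' h
  have h1 := hinj (a₁ := fun i => (m i : ℂ)) (a₂ := fun i => (m' i : ℂ))
    (by rw [← hcast, ← hcast, h])
  ext i
  exact_mod_cast congrFun h1 i

theorem exists_eq_mulVec_add (v : Fin d → ℤ) :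
    ∃ (m : Fin d → ℤ) (e : θ.digits), v = θ.Q.mulVec m + e := by
  obtain ⟨e, ⟨he, m, hm⟩, _⟩ := θ.complete v
  exact ⟨m, ⟨e, he⟩, hm⟩

variable {θ} in
theorem mulVec_add_digit_inj {m m' : Fin d → ℤ} {e e' : θ.digits}
    (h : θ.Q.mulVec m + e = θ.Q.mulVec m' + e') : m = m' ∧ e = e' := by
  have he : (e : Fin d → ℤ) = e' :=
    (θ.complete (θ.Q.mulVec m + e)).unique ⟨e.2, m, rfl⟩ ⟨e'.2, m', h⟩
  refine ⟨θ.mulVec_injective ?_, Subtype.ext he⟩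
  rw [he] at h
  exact add_right_cancel h

section Supertiles

variable {θ}

theorem Supertile.unique {n : ℕ} {a : A} {v : Fin d → ℤ} {b b' : A}
    (h : θ.Supertile n a v b) (h' : θ.Supertile n a v b') : b = b' := by
  induction n generalizing v b b' with
  | zero => exact h.2.trans h'.2.symm
  | succ n ih =>
    obtain ⟨j, c, e, hj, hv, rfl⟩ := h
    obtain ⟨j', c', e', hj', hv', rfl⟩ := h'
    obtain ⟨rfl, rfl⟩ := mulVec_add_digit_inj (hv.symm.trans hv')
    rw [ih hj hj']

/-- With `Supertile.exists_of_add`: an `(m + n)`-supertile is tiled by `n`-supertiles placed at the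
points `Q^n j`. -/
theorem Supertile.add {m n : ℕ} {a c b : A} {j v : Fin d → ℤ} (hj : θ.Supertile m a j c)
    (hv : θ.Supertile n c v b) : θ.Supertile (m + n) a ((θ.Q ^ n).mulVec j + v) b := by
  induction n generalizing v b with
  | zero =>
    obtain ⟨rfl, rfl⟩ := hv
    simpa using hj
  | succ n ih =>
    obtain ⟨w, c', e, hw, rfl, rfl⟩ := hv
    refine ⟨_, c', e, ih hw, ?_, rfl⟩
    rw [Matrix.mulVec_add, Matrix.mulVec_mulVec, ← pow_succ', add_assoc]

theorem Supertile.exists_of_add {m n : ℕ} {a b : A} {v : Fin d → ℤ}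
    (h : θ.Supertile (m + n) a v b) : ∃ j c w, θ.Supertile m a j c ∧ θ.Supertile n c w b ∧
      v = (θ.Q ^ n).mulVec j + w := by
  induction n generalizing v b with
  | zero => exact ⟨v, b, 0, h, ⟨rfl, rfl⟩, by simp⟩
  | succ n ih =>
    obtain ⟨i, c', e, hi, rfl, rfl⟩ := h
    obtain ⟨j, c, w, hj, hw, rfl⟩ := ih hi
    refine ⟨j, c, θ.Q.mulVec w + e, hj, ⟨w, c', e, hw, rfl, rfl⟩, ?_⟩
    rw [Matrix.mulVec_add, Matrix.mulVec_mulVec, ← pow_succ', add_assoc]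

theorem exists_supertile (n : ℕ) (a : A) : ∃ v b, θ.Supertile n a v b := by
  induction n with
  | zero => exact ⟨0, a, rfl, rfl⟩
  | succ n ih =>
    obtain ⟨v, b, h⟩ := ih
    -- Decomposing `0` only serves to produce some digit.
    obtain ⟨_, e, _⟩ := θ.exists_eq_mulVec_add 0
    exact ⟨_, _, v, b, e, h, rfl, rfl⟩

theorem finite_supertile_support (n : ℕ) : {v | ∃ a b, θ.Supertile n a v b}.Finite := by
  induction n with
  | zero => exact (Set.finite_singleton 0).subset (by rintro v ⟨a, b, rfl, _⟩; rfl)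
  | succ n ih =>
    refine (Set.Finite.image2 (fun j e => θ.Q.mulVec j + e) ih θ.digits.finite_toSet).subset ?_
    rintro v ⟨a, b, j, c, e, hj, rfl, _⟩
    exact ⟨j, ⟨a, c, hj⟩, e, e.2, rfl⟩

theorem Primitive.exists_forall_ge (hprim : θ.Primitive) :
    ∃ K : ℕ, ∀ k, K ≤ k → ∀ a b : A, ∃ v, θ.Supertile k a v b := by
  obtain ⟨K, hK⟩ := hprim
  refine ⟨K, fun k hk => ?_⟩
  induction k, hk using Nat.le_induction with
  | base => exact hK
  | succ k _ ih =>
    intro a b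
    obtain ⟨j, c, hj⟩ := exists_supertile (θ := θ) 1 a
    obtain ⟨v, hv⟩ := ih c b
    rw [add_comm]
    exact ⟨_, hj.add hv⟩

/-- A legal pattern occurs in all supertiles of sufficiently high level. -/
theorem Primitive.exists_occurs_in_supertiles (hprim : θ.Primitive) {B : Finset (Fin d → ℤ)}
    {P : B → A} (hP : P ∈ θ.language B) :
    ∃ n₀ : ℕ, ∀ n, n₀ ≤ n → ∀ a, ∃ t, ∀ b : B, θ.Supertile n a (b + t) (P b) := by
  obtain ⟨K, hK⟩ := hprim.exists_forall_ge
  obtain ⟨c, k, t, _, h⟩ := hP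
  refine ⟨K + k, fun n hn a => ?_⟩
  obtain ⟨v, hv⟩ := hK (n - k) (by omega) a c
  refine ⟨(θ.Q ^ k).mulVec v + t, fun b => ?_⟩
  have h1 := hv.add (h b)
  rwa [Nat.sub_add_cancel (by omega), add_left_comm] at h1

theorem Primitive.letter_mem_language (hprim : θ.Primitive) (a : A) :
    (fun _ => a) ∈ θ.language {0} := by
  obtain ⟨K, hK⟩ := hprim.exists_forall_ge
  obtain ⟨v, hv⟩ := hK (K + 1) (by omega) a a
  refine ⟨a, K + 1, v, by omega, fun b => ?_⟩
  have hb : (b : Fin d → ℤ) = 0 := Finset.mem_singleton.mp b.2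
  rwa [hb, zero_add]

/-- Every legal pattern occurs in every point of the shift space. -/
theorem Primitive.exists_occurs (hprim : θ.Primitive) {B : Finset (Fin d → ℤ)} {P : B → A}
    (hP : P ∈ θ.language B) (x : θ.shiftSpace) : ∃ s, ∀ b : B, x.1 (b + s) = P b := by
  classical
  obtain ⟨n, hn⟩ := hprim.exists_occurs_in_supertiles hP
  have hn := hn n le_rfl
  let D : Finset (Fin d → ℤ) := (finite_supertile_support (θ := θ) n).toFinset
  have hD : ∀ {a v b}, θ.Supertile n a v b → v ∈ D := fun h =>
    (Set.Finite.mem_toFinset _).mpr ⟨_, _, h⟩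
  -- `U` contains every translate of an `n`-supertile support that covers the origin. The patch of
  -- `x` on `U` therefore contains a complete `n`-supertile, in which `P` occurs.
  let U : Finset (Fin d → ℤ) := insert 0 (Finset.image₂ (fun v w => v - w) D D)
  obtain ⟨m₀, hm₀⟩ := hprim.exists_occurs_in_supertiles (x.2 U)
  obtain ⟨t, ht⟩ := hm₀ (m₀ + n) (by omega) (x.1 0)
  have h0 := ht ⟨0, Finset.mem_insert_self _ _⟩
  obtain ⟨j, c, w, hj, hw, htw⟩ := h0.exists_of_add
  obtain ⟨s, hs⟩ := hn c
  refine ⟨s - w, fun b => ?_⟩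
  have hU : (b : Fin d → ℤ) + (s - w) ∈ U := by
    refine Finset.mem_insert_of_mem (Finset.mem_image₂.mpr ⟨_, hD (hs b), _, hD hw, ?_⟩)
    abel
  have h1 := ht ⟨_, hU⟩
  have h2 := hj.add (hs b)
  have h3 : (b : Fin d → ℤ) + (s - w) + t = (θ.Q ^ n).mulVec j + (b + s) := by
    have : t = (θ.Q ^ n).mulVec j + w := by simpa using htw
    rw [this]; abel
  rw [← h3] at h2
  exact h1.unique h2

end Supertiles

/-- The substitution acting on configurations. -/
noncomputable def substitute (x : (Fin d → ℤ) → A) (v : Fin d → ℤ) : A :=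
  θ.rule (x (θ.exists_eq_mulVec_add v).choose)
    (θ.exists_eq_mulVec_add v).choose_spec.choose

theorem substitute_mulVec_add (x : (Fin d → ℤ) → A) (m : Fin d → ℤ) (e : θ.digits) :
    θ.substitute x (θ.Q.mulVec m + e) = θ.rule (x m) e := by
  have h := (θ.exists_eq_mulVec_add (θ.Q.mulVec m + e)).choose_spec.choose_spec
  obtain ⟨h1, h2⟩ := mulVec_add_digit_inj h
  exact congrArg₂ (fun m e => θ.rule (x m) e) h1.symm h2.symm

theorem substitute_mem_shiftSpace {x : (Fin d → ℤ) → A} (hx : x ∈ θ.shiftSpace) :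
    θ.substitute x ∈ θ.shiftSpace := by
  classical
  intro B
  choose m e hme using θ.exists_eq_mulVec_add
  obtain ⟨a, k, t, _, h⟩ := hx (B.image m)
  refine ⟨a, k + 1, θ.Q.mulVec t, by omega, fun b => ?_⟩
  refine ⟨m b + t, x (m b), e b, h ⟨m b, Finset.mem_image_of_mem _ b.2⟩, ?_, ?_⟩
  · rw [Matrix.mulVec_add, add_right_comm, ← hme]
  · rw [← substitute_mulVec_add, ← hme]

theorem iterate_substitute_mem_shiftSpace {x : (Fin d → ℤ) → A} (hx : x ∈ θ.shiftSpace) (n : ℕ) :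
    θ.substitute^[n] x ∈ θ.shiftSpace := by
  induction n with
  | zero => exact hx
  | succ n ih =>
    rw [Function.iterate_succ_apply']
    exact θ.substitute_mem_shiftSpace ih

variable {θ} in
theorem Supertile.iterate_substitute_eq {n : ℕ} {x : (Fin d → ℤ) → A} {i v : Fin d → ℤ} {b : A}
    (h : θ.Supertile n (x i) v b) : θ.substitute^[n] x ((θ.Q ^ n).mulVec i + v) = b := by
  induction n generalizing v b with
  | zero =>
    obtain ⟨rfl, rfl⟩ := h
    simp
  | succ n ih =>
    obtain ⟨j, c, e, hj, rfl, rfl⟩ := h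
    rw [Function.iterate_succ_apply', pow_succ', ← Matrix.mulVec_mulVec, ← add_assoc,
      ← Matrix.mulVec_add, substitute_mulVec_add, ih hj]

/-! ### The return module: invariance and finite index -/

section ReturnTimes

variable {θ}

/-- Equal letters of `x` at distance `j` give equal letters of `θ(x)` at distance `Q j`. This
two-point pattern is legal, so it recurs in `x`. -/
theorem Primitive.mulVec_mem_returnTimes (hprim : θ.Primitive) (x : θ.shiftSpace)
    {j : Fin d → ℤ} (hj : j ∈ returnTimes x.1) : θ.Q.mulVec j ∈ returnTimes x.1 := by
  classical
  obtain ⟨k, hk⟩ := hj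
  obtain ⟨_, e, _⟩ := θ.exists_eq_mulVec_add 0
  let u : Fin d → ℤ := θ.Q.mulVec k + e
  let u' : Fin d → ℤ := θ.Q.mulVec (j + k) + e
  obtain ⟨s, hs⟩ := hprim.exists_occurs (θ.substitute_mem_shiftSpace x.2 {u, u'}) x
  have h1 := hs ⟨u, by simp⟩
  have h2 := hs ⟨u', by simp⟩
  simp only [u, u', substitute_mulVec_add] at h1 h2
  refine ⟨θ.Q.mulVec k + e + s, ?_⟩
  rw [h1, ← hk, ← h2, Matrix.mulVec_add]
  simp only [add_assoc]

theorem Primitive.mulVec_mem_returnModule (hprim : θ.Primitive) (x : θ.shiftSpace)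
    {j : Fin d → ℤ} (hj : j ∈ returnModule x.1) : θ.Q.mulVec j ∈ returnModule x.1 := by
  have h : returnModule x.1 ≤ (returnModule x.1).comap θ.Q.mulVecLin.toAddMonoidHom :=
    (AddSubgroup.closure_le _).mpr fun j hj =>
      AddSubgroup.subset_closure (hprim.mulVec_mem_returnTimes x hj)
  exact h hj

/-- Among the positions `0, v, …, |A| v` two carry the same letter, so `r v` is a return time for
some `1 ≤ r ≤ |A|`; the factor `|A|!` serves all `v`. -/
theorem exists_pos_forall_nsmul_mem_returnModule [Finite A] (x : (Fin d → ℤ) → A) :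
    ∃ N : ℕ, 0 < N ∧ ∀ v : Fin d → ℤ, N • v ∈ returnModule x := by
  have : Fintype A := Fintype.ofFinite A
  refine ⟨(Fintype.card A).factorial, Nat.factorial_pos _, fun v => ?_⟩
  obtain ⟨p, q, hpq, h⟩ := Fintype.exists_ne_map_eq_of_card_lt
    (fun p : Fin (Fintype.card A + 1) => x ((p : ℕ) • v)) (by simp)
  wlog hlt : p < q generalizing p q
  · exact this q p hpq.symm h.symm (lt_of_le_of_ne (not_lt.mp hlt) hpq.symm)
  have hlt' : (p : ℕ) < q := hlt
  have hmem : ((q : ℕ) - p) • v ∈ returnModule x := by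
    refine AddSubgroup.subset_closure ⟨(p : ℕ) • v, ?_⟩
    rw [← add_smul, Nat.sub_add_cancel hlt'.le]
    exact h.symm
  obtain ⟨r, hr⟩ : (q : ℕ) - p ∣ (Fintype.card A).factorial :=
    Nat.dvd_factorial (by omega) (by have := q.2; omega)
  rw [hr, mul_comm, mul_smul]
  exact AddSubgroup.nsmul_mem _ hmem r

theorem finite_quotient_of_nsmul_mem {L : AddSubgroup (Fin d → ℤ)} {N : ℕ} (hN : 0 < N)
    (h : ∀ v : Fin d → ℤ, N • v ∈ L) : Finite ((Fin d → ℤ) ⧸ L) := by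
  have : NeZero N := ⟨hN.ne'⟩
  refine Finite.of_surjective
    (fun c : Fin d → ZMod N => (((fun i => ((c i).val : ℤ)) : Fin d → ℤ) : (Fin d → ℤ) ⧸ L)) ?_
  intro g
  obtain ⟨w, rfl⟩ := QuotientAddGroup.mk_surjective g
  refine ⟨fun i => (w i : ZMod N), ?_⟩
  rw [QuotientAddGroup.eq]
  have h1 := h (fun i => w i / N)
  convert h1 using 1
  ext i
  simp only [Pi.add_apply, Pi.neg_apply, Pi.smul_apply, nsmul_eq_mul, ZMod.val_intCast]
  have := Int.emod_add_mul_ediv (w i) N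
  linarith

end ReturnTimes

/-! ### Compactness of the shift space -/

section Topology

variable [TopologicalSpace A] [DiscreteTopology A]

theorem isClosed_setOf_restrict_mem (B : Finset (Fin d → ℤ)) (S : Set (B → A)) :
    IsClosed {x : (Fin d → ℤ) → A | (fun b : B => x b) ∈ S} :=
  (isClosed_discrete S).preimage (by fun_prop)

theorem isClosed_shiftSpace : IsClosed θ.shiftSpace := by
  have h : θ.shiftSpace =
      ⋂ B : Finset (Fin d → ℤ), {x | (fun b : B => x b) ∈ θ.language B} := by
    ext x
    simp [shiftSpace]
  rw [h]
  exact isClosed_iInter fun B => isClosed_setOf_restrict_mem B _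

instance compactSpace_shiftSpace [Finite A] : CompactSpace θ.shiftSpace :=
  isCompact_iff_compactSpace.mp θ.isClosed_shiftSpace.isCompact

variable {θ} in
theorem Extensible.shiftSpace_nonempty [Finite A] [Nonempty A] (hext : θ.Extensible) :
    θ.shiftSpace.Nonempty := by
  classical
  have h := IsCompact.nonempty_iInter_of_directed_nonempty_isCompact_isClosed
    (fun B : Finset (Fin d → ℤ) => {x : (Fin d → ℤ) → A | (fun b : B => x b) ∈ θ.language B})
    ?_ ?_ (fun B => (isClosed_setOf_restrict_mem B _).isCompact)
    (fun B => isClosed_setOf_restrict_mem B _)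
  · obtain ⟨x, hx⟩ := h
    exact ⟨x, fun B => Set.mem_iInter.mp hx B⟩
  · have anti : ∀ B C : Finset (Fin d → ℤ), B ⊆ C →
        {x : (Fin d → ℤ) → A | (fun b : C => x b) ∈ θ.language C} ⊆
          {x | (fun b : B => x b) ∈ θ.language B} := by
      rintro B C hBC x ⟨a, k, t, hk, h⟩
      exact ⟨a, k, t, hk, fun b => h ⟨b, hBC b.2⟩⟩
    exact fun B C => ⟨B ∪ C, anti _ _ Finset.subset_union_left,
      anti _ _ Finset.subset_union_right⟩
  · intro B
    -- Extending the empty pattern, which is legal, yields a legal pattern on `B`.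
    obtain ⟨R, hR, _⟩ := hext ∅ (fun b => absurd b.2 (Finset.notMem_empty _))
      ⟨Classical.arbitrary A, 1, 0, le_rfl, fun b => absurd b.2 (Finset.notMem_empty _)⟩
      B (Finset.empty_subset _)
    refine ⟨fun v => if hv : v ∈ B then R ⟨v, hv⟩ else Classical.arbitrary A, ?_⟩
    simpa using hR

variable {θ}

/-- Continuous functions on the shift space are uniformly continuous: up to `ε`, the value is
determined by the symbols at finitely many positions. -/
theorem exists_finset_forall_dist_lt [Finite A] {Y : Type*} [PseudoMetricSpace Y]
    {f : θ.shiftSpace → Y} (hf : Continuous f) {ε : ℝ} (hε : 0 < ε) :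
    ∃ B : Finset (Fin d → ℤ), ∀ x y : θ.shiftSpace, (∀ b ∈ B, x.1 b = y.1 b) →
      dist (f x) (f y) < ε := by
  classical
  have hcont : ∀ v : Fin d → ℤ, Continuous fun y : θ.shiftSpace => y.1 v := fun v =>
    (continuous_apply v).comp continuous_subtype_val
  have hcyl : ∀ (B : Finset (Fin d → ℤ)) (x : θ.shiftSpace),
      {y : θ.shiftSpace | ∀ b ∈ B, y.1 b = x.1 b} ∈ 𝓝 x := by
    intro B x
    simp only [Set.ofPred_forall]
    exact (Filter.biInter_finset_mem B).mpr fun b _ =>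
      ((isOpen_discrete {x.1 b}).preimage (hcont b)).mem_nhds rfl
  have hloc : ∀ x : θ.shiftSpace, ∃ B : Finset (Fin d → ℤ),
      ∀ y : θ.shiftSpace, (∀ b ∈ B, y.1 b = x.1 b) → dist (f y) (f x) < ε / 2 := by
    intro x
    have h1 : f ⁻¹' Metric.ball (f x) (ε / 2) ∈ 𝓝 x :=
      hf.continuousAt.preimage_mem_nhds (Metric.ball_mem_nhds _ (half_pos hε))
    rw [nhds_induced, Filter.mem_comap] at h1
    obtain ⟨S, hS, hSf⟩ := h1
    rw [nhds_pi, Filter.mem_pi] at hS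
    obtain ⟨I, hI, t, ht, hIt⟩ := hS
    refine ⟨hI.toFinset, fun y hy => ?_⟩
    have hyS : y ∈ f ⁻¹' Metric.ball (f x) (ε / 2) := by
      refine hSf (hIt fun i hi => ?_)
      rw [hy i (hI.mem_toFinset.mpr hi)]
      exact mem_of_mem_nhds (ht i)
    exact hyS
  choose C hC using hloc
  obtain ⟨F, hF⟩ := CompactSpace.elim_nhds_subcover _ fun x => hcyl (C x) x
  refine ⟨F.biUnion C, fun x y hxy => ?_⟩
  have hx : x ∈ ⋃ z ∈ F, {y : θ.shiftSpace | ∀ b ∈ C z, y.1 b = z.1 b} := by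
    rw [hF]; trivial
  simp only [Set.mem_iUnion, Set.mem_ofPred_eq] at hx
  obtain ⟨z, hz, hxz⟩ := hx
  have h1 := hC z x hxz
  have h2 := hC z y fun b hb => by
    rw [← hxy b (Finset.mem_biUnion.mpr ⟨z, hz, hb⟩), hxz b hb]
  have h3 := dist_triangle_right (f x) (f y) (f z)
  linarith

end Topology

end DigitSubstitution

/-! ### Eigenvalues and eigenfunctions -/

namespace DigitSubstitution

variable {d : ℕ} {A : Type*} {θ : DigitSubstitution d A}

theorem iterate_mulVecLin_apply (Q : Matrix (Fin d) (Fin d) ℤ) (n : ℕ) (v : Fin d → ℤ) :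
    Q.mulVecLin.toAddMonoidHom^[n] v = (Q ^ n).mulVec v := by
  induction n with
  | zero => simp
  | succ n ih =>
    rw [Function.iterate_succ_apply', ih, pow_succ', ← Matrix.mulVec_mulVec]
    rfl

theorem shift_shift (m n : Fin d → ℤ) (x : θ.shiftSpace) :
    θ.shift m (θ.shift n x) = θ.shift (m + n) x := by
  refine Subtype.ext (funext fun i => ?_)
  simp only [shift, add_assoc]

section Eigenfunctions

variable [TopologicalSpace A]

theorem IsEigenfunction.exists_addChar {f : θ.shiftSpace → Circle} (hf : θ.IsEigenfunction f)
    (x₀ : θ.shiftSpace) :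
    ∃ χ : AddChar (Fin d → ℤ) Circle, ∀ n x, f (θ.shift n x) = χ n * f x := by
  choose c hc using hf.2
  have hadd : ∀ m n, c (m + n) = c m * c n := by
    intro m n
    have h := hc (m + n) x₀
    rw [← shift_shift, hc, hc, ← mul_assoc] at h
    exact (mul_right_cancel h).symm
  have hzero : c 0 = 1 := by
    have h := hadd 0 0
    rw [add_zero] at h
    exact left_eq_mul.mp h
  exact ⟨⟨c, hzero, hadd⟩, hc⟩

variable [DiscreteTopology A]

/-- An eigenvalue `χ` is close to `1` on `Q^n j`, uniformly for all return times `j`. -/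
theorem Primitive.exists_forall_dist_eigenvalue_lt [Finite A] (hprim : θ.Primitive)
    {f : θ.shiftSpace → Circle} (hf : Continuous f) {χ : AddChar (Fin d → ℤ) Circle}
    (hχ : ∀ n x, f (θ.shift n x) = χ n * f x) (x₀ : θ.shiftSpace)
    {ε : ℝ} (hε : 0 < ε) :
    ∃ n₀ : ℕ, ∀ n, n₀ ≤ n → ∀ j ∈ returnTimes x₀.1, dist (χ ((θ.Q ^ n).mulVec j)) 1 < ε := by
  obtain ⟨B, hB⟩ := exists_finset_forall_dist_lt hf hε
  obtain ⟨n₀, hn₀⟩ := hprim.exists_occurs_in_supertiles (x₀.2 B)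
  refine ⟨n₀, fun n hn j hj => ?_⟩
  obtain ⟨k, hk⟩ := hj
  obtain ⟨t, ht⟩ := hn₀ n hn (x₀.1 k)
  -- In `y = θ^n(x₀)` the same `n`-supertile sits at `Q^n k` and at `Q^n (j + k)`, and it contains
  -- the patch of `x₀` on `B` at offset `t`. So `z` and its shift by `Q^n j` agree on `B`.
  let y : θ.shiftSpace := ⟨_, θ.iterate_substitute_mem_shiftSpace x₀.2 n⟩
  let z : θ.shiftSpace := θ.shift ((θ.Q ^ n).mulVec k + t) y
  have hz := hB (θ.shift ((θ.Q ^ n).mulVec j) z) z fun b hb => by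
    have h1 : θ.substitute^[n] x₀.1 ((θ.Q ^ n).mulVec k + (b + t)) = x₀.1 b :=
      (ht ⟨b, hb⟩).iterate_substitute_eq
    have h2 : θ.substitute^[n] x₀.1 ((θ.Q ^ n).mulVec (j + k) + (b + t)) = x₀.1 b :=
      Supertile.iterate_substitute_eq (by rw [hk]; exact ht ⟨b, hb⟩)
    have e1 : b + ((θ.Q ^ n).mulVec k + t) = (θ.Q ^ n).mulVec k + (b + t) := by abel
    have e2 : b + (θ.Q ^ n).mulVec j + ((θ.Q ^ n).mulVec k + t) =
        (θ.Q ^ n).mulVec (j + k) + (b + t) := by rw [Matrix.mulVec_add]; abel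
    change θ.substitute^[n] x₀.1 (b + (θ.Q ^ n).mulVec j + ((θ.Q ^ n).mulVec k + t)) =
      θ.substitute^[n] x₀.1 (b + ((θ.Q ^ n).mulVec k + t))
    rw [e1, e2, h1, h2]
  rw [hχ] at hz
  have hd : dist (χ ((θ.Q ^ n).mulVec j) * f z) (f z) = dist (χ ((θ.Q ^ n).mulVec j)) 1 := by
    change dist ((χ ((θ.Q ^ n).mulVec j) * f z : Circle) : ℂ) (f z) =
      dist (χ ((θ.Q ^ n).mulVec j) : ℂ) ((1 : Circle) : ℂ)
    rw [dist_eq_norm, dist_eq_norm]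
    have h : ((χ ((θ.Q ^ n).mulVec j) * f z : Circle) : ℂ) - (f z : ℂ) =
        ((χ ((θ.Q ^ n).mulVec j) : ℂ) - ((1 : Circle) : ℂ)) * (f z : ℂ) := by
      rw [Circle.coe_mul, Circle.coe_one]; ring
    rw [h, norm_mul, Circle.norm_coe, mul_one]
  rwa [hd] at hz

/-- Every eigenvalue is trivial on `Q^n L` for large `n`, where `L` is the return module. -/
theorem Primitive.exists_eigenvalue_trivial_on_returnModule [Finite A] (hprim : θ.Primitive)
    {f : θ.shiftSpace → Circle} (hf : Continuous f) {χ : AddChar (Fin d → ℤ) Circle}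
    (hχ : ∀ n x, f (θ.shift n x) = χ n * f x) (x₀ : θ.shiftSpace) :
    ∃ n : ℕ, ∀ j ∈ returnModule x₀.1, χ ((θ.Q ^ n).mulVec j) = 1 := by
  have hclose := fun {ε : ℝ} (hε : 0 < ε) =>
    hprim.exists_forall_dist_eigenvalue_lt hf hχ x₀ hε
  have hlim : ∀ j ∈ returnModule x₀.1,
      Tendsto (fun n : ℕ => χ ((θ.Q ^ n).mulVec j)) atTop (𝓝 1) := by
    intro j hj
    induction hj using AddSubgroup.closure_induction with
    | mem j hj =>
      refine Metric.tendsto_atTop.mpr fun ε hε => ?_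
      obtain ⟨n₀, hn₀⟩ := hclose hε
      exact ⟨n₀, fun n hn => hn₀ n hn j hj⟩
    | zero => simp
    | add a b _ _ ha hb => simpa [Matrix.mulVec_add, AddChar.map_add_eq_mul] using ha.mul hb
    | neg a _ ha => simpa [Matrix.mulVec_neg, AddChar.map_neg_eq_inv] using ha.inv
  obtain ⟨N, hN, hNL⟩ := exists_pos_forall_nsmul_mem_returnModule x₀.1
  obtain ⟨n₁, hn₁⟩ := AddChar.exists_forall_pow_mulVec_eq_one θ.Q θ.expansive (χ ^ N) fun v => by
    refine (hlim _ (hNL v)).congr fun n => ?_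
    rw [Matrix.mulVec_smul, AddChar.map_nsmul_eq_pow, AddChar.pow_apply]
  have hroots : {z : Circle | z ^ N = 1}.Finite := by
    have : NeZero N := ⟨hN.ne'⟩
    have h : Set.Finite ((fun z : Circle => (z : ℂ)) ⁻¹' {z : ℂ | z ^ N = 1}) := by
      refine Set.Finite.preimage Circle.coe_injective.injOn ?_
      refine (Polynomial.nthRootsFinset N (1 : ℂ)).finite_toSet.subset fun z hz => ?_
      exact (Polynomial.mem_nthRootsFinset hN 1).mpr hz
    refine h.subset fun z hz => ?_
    have hz' : z ^ N = 1 := hz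
    change (z : ℂ) ^ N = 1
    rw [← Circle.coe_pow, hz', Circle.coe_one]
  -- A neighbourhood of `1` that avoids all other `N`-th roots of unity. The level `n₂` obtained
  -- from it serves all return times at once.
  have hnhds : ({z : Circle | z ^ N = 1} \ {1})ᶜ ∈ 𝓝 (1 : Circle) :=
    (hroots.subset Set.sdiff_subset).isClosed.isOpen_compl.mem_nhds (by simp)
  obtain ⟨ε, hε, hball⟩ := Metric.mem_nhds_iff.mp hnhds
  obtain ⟨n₂, hn₂⟩ := hclose hε
  refine ⟨n₁ + n₂, fun j hj => ?_⟩
  induction hj using AddSubgroup.closure_induction with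
  | mem j hj =>
    have h1 : χ ((θ.Q ^ (n₁ + n₂)).mulVec j) ^ N = 1 := by
      rw [pow_add, ← Matrix.mulVec_mulVec, ← AddChar.pow_apply]
      exact hn₁ _
    by_contra hne
    exact hball (hn₂ (n₁ + n₂) (by omega) j hj) ⟨h1, hne⟩
  | zero => simp
  | add a b _ _ ha hb => simp [Matrix.mulVec_add, AddChar.map_add_eq_mul, ha, hb]
  | neg a _ ha => simp [Matrix.mulVec_neg, AddChar.map_neg_eq_inv, ha]

/-- Every character that is trivial on the return module is an eigenvalue: it has an
eigenfunction that depends only on the symbol at the origin. -/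
theorem Primitive.exists_eigenfunction_of_trivial_on_returnModule (hprim : θ.Primitive)
    (x₀ : θ.shiftSpace) (η : AddChar (Fin d → ℤ) Circle)
    (hη : ∀ j ∈ returnModule x₀.1, η j = 1) :
    ∃ h : θ.shiftSpace → Circle, Continuous h ∧ ∀ n x, h (θ.shift n x) = η n * h x := by
  classical
  have hpos : ∀ a : A, ∃ p, x₀.1 p = a := fun a => by
    obtain ⟨s, hs⟩ := hprim.exists_occurs (hprim.letter_mem_language a) x₀
    exact ⟨_, hs ⟨0, by simp⟩⟩
  choose p hp using hpos
  -- Positions of the same letter in `x₀` differ by return times, so `η` of the position depends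
  -- only on the letter.
  have key : ∀ s, η (p (x₀.1 s)) = η s := by
    intro s
    have h1 : p (x₀.1 s) - s ∈ returnModule x₀.1 :=
      AddSubgroup.subset_closure ⟨s, by rw [sub_add_cancel, hp]⟩
    have h2 := hη _ h1
    rwa [AddChar.map_sub_eq_div, div_eq_one] at h2
  refine ⟨fun x => η (p (x.1 0)), ?_, fun n x => ?_⟩
  · exact (continuous_of_discreteTopology (f := fun a => η (p a))).comp
      ((continuous_apply 0).comp continuous_subtype_val)
  · obtain ⟨s, hs⟩ := hprim.exists_occurs (x.2 {0, n}) x₀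
    have h0 : x₀.1 (0 + s) = x.1 0 := hs ⟨0, by simp⟩
    have hn : x₀.1 (n + s) = x.1 (0 + n) := by
      rw [zero_add]; exact hs ⟨n, by simp⟩
    change η (p (x.1 (0 + n))) = η n * η (p (x.1 0))
    rw [← h0, ← hn, key, key, AddChar.map_add_eq_mul, zero_add]

end Eigenfunctions

end DigitSubstitution

/-! ### The height lattice and the factorization of eigenfunctions -/

theorem mainTheorem9 {d : ℕ} {A : Type*} [Finite A] [Nonempty A]
    [TopologicalSpace A] [DiscreteTopology A]
    (θ : DigitSubstitution d A) (hprim : θ.Primitive) (hext : θ.Extensible) :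
    θ.shiftSpace.Nonempty ∧
    ∀ x₀ : θ.shiftSpace, ∃ Γ : AddSubgroup (Fin d → ℤ),
      θ.IsHeightLattice x₀ Γ ∧
      -- if there is a smallest lattice even without `Q`-invariance, then it is `Γ`
      (∀ Λ : AddSubgroup (Fin d → ℤ),
        IsLeast {Λ' : AddSubgroup (Fin d → ℤ) |
          DigitSubstitution.returnModule x₀.1 ≤ Λ' ∧ θ.CoprimeToSupertiles Λ'} Λ → Λ = Γ) ∧
      ∀ f : θ.shiftSpace → Circle, θ.IsEigenfunction f →
        ∃ ftile h : θ.shiftSpace → Circle,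
          θ.IsEigenfunction ftile ∧ θ.IsEigenfunction h ∧
          (∀ x, f x = ftile x * h x) ∧
          (∃ k : ℕ, ∀ (m : Fin d → ℤ) (x : θ.shiftSpace),
            ftile (θ.shift ((θ.Q ^ k).mulVec m) x) = ftile x) ∧
          (∀ n ∈ Γ, ∀ x : θ.shiftSpace, h (θ.shift n x) = h x) := by
  refine ⟨hext.shiftSpace_nonempty, fun x₀ => ?_⟩
  let q : (Fin d → ℤ) →+ (Fin d → ℤ) := θ.Q.mulVecLin.toAddMonoidHom
  let L := DigitSubstitution.returnModule x₀.1
  have hL : ∀ v ∈ L, q v ∈ L := fun v hv => hprim.mulVec_mem_returnModule x₀ hv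
  obtain ⟨N, hN, hNL⟩ := DigitSubstitution.exists_pos_forall_nsmul_mem_returnModule x₀.1
  have : Finite ((Fin d → ℤ) ⧸ L) := DigitSubstitution.finite_quotient_of_nsmul_mem hN hNL
  have hΓL : L ≤ L.eventualComap q hL := AddSubgroup.le_eventualComap hL
  have hΓinv : ∀ v ∈ L.eventualComap q hL, q v ∈ L.eventualComap q hL := fun v hv =>
    AddSubgroup.map_mem_eventualComap hL hv
  have hΓcop := AddSubgroup.eventualComap_coprime hL
  refine ⟨L.eventualComap q hL, ⟨⟨hΓL, hΓcop, hΓinv⟩, ?_⟩, ?_, ?_⟩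
  · rintro Λ ⟨h1, h2, h3⟩
    exact AddSubgroup.eventualComap_le hL h1 h3 h2
  · intro Λ hΛ
    -- `Γ` competes for minimality with `Λ`; conversely `Λ` is automatically `Q`-invariant, so it
    -- contains `Γ`.
    refine le_antisymm (hΛ.2 ⟨hΓL, hΓcop⟩) ?_
    exact AddSubgroup.eventualComap_le hL hΛ.1.1
      (fun v hv => AddSubgroup.map_mem_of_isLeast_coprime hL hΛ hv) hΛ.1.2
  · intro f hf
    obtain ⟨χ, hχ⟩ := hf.exists_addChar x₀
    obtain ⟨n, hn⟩ := hprim.exists_eigenvalue_trivial_on_returnModule hf.1 hχ x₀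
    obtain ⟨K, hK⟩ := AddSubgroup.exists_uniform_eventualComap hL
    -- The exponent is `n + K`: `Q^K` carries `Γ` into `L`, and `χ` is trivial on `Q^n L`.
    obtain ⟨η, hηΓ, hη⟩ := AddChar.exists_trivial_on_of_coprime χ hΓinv hΓcop
      (fun i v ⟨j, hj⟩ => ⟨j + i, by rwa [Function.iterate_add_apply]⟩) (K := n + K)
      fun v hv => by
        rw [Function.iterate_add_apply, DigitSubstitution.iterate_mulVecLin_apply]
        exact hn _ (hK v hv)
    obtain ⟨h, hcont, hh⟩ := hprim.exists_eigenfunction_of_trivial_on_returnModule x₀ η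
      fun j hj => hηΓ j (hΓL hj)
    have hft : ∀ m x, f (θ.shift m x) / h (θ.shift m x) = (χ m / η m) * (f x / h x) := by
      intro m x
      rw [hχ, hh, mul_div_mul_comm]
    refine ⟨fun x => f x / h x, h, ⟨hf.1.div' hcont, fun m => ⟨_, hft m⟩⟩,
      ⟨hcont, fun m => ⟨_, hh m⟩⟩, fun x => (div_mul_cancel _ _).symm, ⟨n + K, fun m x => ?_⟩,
      fun γ hγ x => by rw [hh, hηΓ γ hγ, one_mul]⟩
    have h1 := hη m
    rw [DigitSubstitution.iterate_mulVecLin_apply] at h1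
    change f _ / h _ = _
    rw [hft, h1, div_self', one_mul]
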